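/- Let $K$ be a complete field of characteristic $0$ with an ultrametric absolute value (possibly trivial), and let $\Omega/K$ be an algebraically closed, spherically complete valued extension with $|\Omega|=\mathbb{R}_{\ge 0}$ such that every point of the Berkovich line $\mathbb{P}^{1,\mathrm{an}}_K$ is $\Omega$-rational; for each point $x$ fix an $\Omega$-rational point $t_x$ over $x$. Definitions. A weak triangulation of an analytic domain $X\subseteq\mathbb{P}^{1,\mathrm{an}}_K$ is a locally finite subset $S\subseteq X$ such that every connected component of $X-S$ is a virtual open disc or a virtual open annulus; its skeleton $\Gamma_S$ is the union of $S$ and of the skeletons of the components that are virtual open annuli; $S_\Omega$ is the canonical extension of $S$ to a weak triangulation of $X_\Omega$, and $D(x,S)$ is the connected component of $X_\Omega-\Gamma_{S_\Omega}$ containing $t_x$. An automorphism $\sigma$ of $X$ is $S$-infinitesimal if $\sigma_\Omega$ induces an automorphism of $D(x,S)$ for all $x\in X$; then $D^+(x,\sigma)$ is the smallest closed disc in $D(x,S)$ containing $t_x$ and $\sigma_\Omega(t_x)$ (it may be a point). A family $\Sigma$ of $S$-infinitesimal automorphisms is non-degenerate on $X$ if every connected component of $X$ contains a point $x$ such that,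 for every open disc $D$ with $\bigcup_{\sigma\in\Sigma}D^+(x,\sigma)\subseteq D\subseteq D(x,S)$, the only functions in $\mathcal{O}(D)$ invariant under all $\sigma_\Omega$, $\sigma\in\Sigma$, are the constants: $\mathcal{O}(D)^{\Sigma_\Omega=1}=\Omega$. For $0<\varepsilon<1$ let $C_\varepsilon=\{1-\varepsilon<|T|<1\}$, with the empty weak triangulation, and let $\mathfrak{R}=\bigcup_\varepsilon\mathcal{O}(C_\varepsilon)$ be the Robba ring. An automorphism of $\mathfrak{R}$ is infinitesimal if it comes from an infinitesimal automorphism of some $C_\varepsilon$; a family $\Sigma$ of such automorphisms is non-degenerate over $\mathfrak{R}$ if for all $\varepsilon>0$ there is $0<\varepsilon'<\min(\varepsilon,1)$ such that the subfamily of those $\sigma\in\Sigma$ that are infinitesimal automorphisms of $C_{\varepsilon'}$ is non-degenerate on $C_{\varepsilon'}$. Statement. Let $q,h\in K$ and $\sigma_{q,h}(T)=qT+h$. If $q=1$ assume $h\neq 0$; if $q\neq 1$ assume that $q$ is not a root of unity. (1) Let $X$ be an analytic domain of $\mathbb{P}^{1,\mathrm{an}}_K$ with a weak triangulation $S$ such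 that $\sigma_{q,h}$ acts $S$-infinitesimally on $X$. If $X$ is not an open disc centred at $\infty$ with empty weak triangulation, then the action of $\{\sigma_{q,h}\}$ is non-degenerate on $X$. (2) If $\sigma_{q,h}$ is an infinitesimal automorphism of the Robba ring $\mathfrak{R}$, then $\{\sigma_{q,h}\}$ is non-degenerate over $\mathfrak{R}$. -/

import Mathlib

open Polynomial

namespace BerkovichLine

noncomputable section

/-! ## The Berkovich line over a complete ultrametric field -/

/-- The analytic affine line over `L`: multiplicative seminorms on `L[T]` that extend the
absolute value of `L`. For `x : AffLine L` and `f : L[X]`, `x.1 f` is the number `|f|(x)`. -/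
def AffLine (L : Type*) [NormedField L] : Type _ :=
  {x : MulRingSeminorm L[X] // ∀ a : L, x (C a) = ‖a‖}

/-- The coarsest topology for which all the functions `x ↦ |f|(x)` are continuous. -/
instance (L : Type*) [NormedField L] : TopologicalSpace (AffLine L) :=
  TopologicalSpace.induced (fun (x : AffLine L) (f : L[X]) => x.1 f) inferInstance

/-- The analytic projective line over `L`. The affine line is locally compact and the projective
line is its one-point compactification. -/
abbrev P1 (L : Type*) [NormedField L] : Type _ := OnePoint (AffLine L)

/-- Pull-back of seminorms along a ring morphism of polynomial rings which is isometric on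
constants. -/
def AffLine.pullback {L M : Type*} [NormedField L] [NormedField M] (φ : L[X] →+* M[X])
    (hφ : ∀ (a : L) (x : AffLine M), x.1 (φ (C a)) = ‖a‖) (x : AffLine M) : AffLine L :=
  ⟨{ toFun := fun f => x.1 (φ f)
     map_zero' := by simp
     add_le' := fun f g => by simpa using map_add_le_add x.1 (φ f) (φ g)
     neg' := fun f => by simp
     map_one' := by simp
     map_mul' := fun f g => by simp }, fun a => hφ a x⟩

/-- The projection from the affine line over `Ω` to the affine line over `K`. -/
def AffLine.proj (K : Type*) {Ω : Type*} [NormedField K] [NormedField Ω] [NormedAlgebra K Ω] :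
    AffLine Ω → AffLine K :=
  AffLine.pullback (mapRingHom (algebraMap K Ω)) fun a x => by
    simpa using x.2 (algebraMap K Ω a)

/-- The projection `π` from the projective line over `Ω` to the projective line over `K`. -/
def proj (K : Type*) {Ω : Type*} [NormedField K] [NormedField Ω] [NormedAlgebra K Ω] :
    P1 Ω → P1 K :=
  OnePoint.map (AffLine.proj K)

/-- The map `T ↦ qT + h` on the affine line: `|f|(σ(x)) = |f(qT + h)|(x)`. -/
def AffLine.sigma {L : Type*} [NormedField L] (q h : L) : AffLine L → AffLine L :=
  AffLine.pullback (compRingHom (C q * X + C h)) fun a x => by simpa using x.2 a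

/-- The map `T ↦ qT + h` on the projective line; it fixes `∞`. -/
def sigma {L : Type*} [NormedField L] (q h : L) : P1 L → P1 L :=
  OnePoint.map (AffLine.sigma q h)

/-- The rational point `c` of the affine line: `|f|(c) = ‖f(c)‖`. -/
def AffLine.rat {L : Type*} [NormedField L] (c : L) : AffLine L :=
  ⟨{ toFun := fun f => ‖f.eval c‖
     map_zero' := by simp
     add_le' := fun f g => by simpa using norm_add_le (f.eval c) (g.eval c)
     neg' := fun f => by simp
     map_one' := by simp
     map_mul' := fun f g => by simp }, fun a => by
    change ‖(C a).eval c‖ = ‖a‖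
    rw [eval_C]⟩

/-- The rational points of the projective line, with `L ∪ {∞}` as set of coordinates. -/
def rat {L : Type*} [NormedField L] : OnePoint L → P1 L :=
  OnePoint.map AffLine.rat

/-- The map `T ↦ qT + h` on `L ∪ {∞}`. -/
def sigmaRat {L : Type*} [NormedField L] (q h : L) : OnePoint L → OnePoint L :=
  OnePoint.map fun z => q * z + h

/-- `x` is the point `x_{c,r}`, i.e. `|f|(x) = sup_n |f⁽ⁿ⁾(c)/n!| rⁿ`. -/
def AffLine.IsGauss {L : Type*} [NormedField L] (x : AffLine L) (c : L) (r : ℝ) : Prop :=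
  ∀ f : L[X], x.1 f = ⨆ n : ℕ, ‖(hasseDeriv n f).eval c‖ * r ^ n

/-! ## Discs and annuli of the projective line -/

/-- The open disc `{|T - c| < r}`. -/
def openDisc {L : Type*} [NormedField L] (c : L) (r : ℝ) : Set (P1 L) :=
  (fun x : AffLine L => (x : P1 L)) '' {x | x.1 (X - C c) < r}

/-- The closed disc `{|T - c| ≤ r}`. -/
def closedDisc {L : Type*} [NormedField L] (c : L) (r : ℝ) : Set (P1 L) :=
  (fun x : AffLine L => (x : P1 L)) '' {x | x.1 (X - C c) ≤ r}

section discs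

variable (K : Type*) {Ω : Type*} [NormedField K] [NormedField Ω] [NormedAlgebra K Ω]

/-- An open disc of the projective line over `Ω` with a centre that is algebraic over `K`
(possibly a disc around `∞`, the complement of a closed disc of positive radius). Centres in the
completed algebraic closure give nothing more, since the radius is positive. -/
def IsOpenDiscOver (D : Set (P1 Ω)) : Prop :=
  ∃ (c : Ω) (r : ℝ), IsAlgebraic K c ∧ 0 < r ∧ (D = openDisc c r ∨ D = (closedDisc c r)ᶜ)

/-- A closed disc of positive radius of the projective line over `Ω` with a centre that is
algebraic over `K`. -/
def IsClosedDiscOver (E : Set (P1 Ω)) : Prop :=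
  ∃ (c : Ω) (r : ℝ), IsAlgebraic K c ∧ 0 < r ∧ (E = closedDisc c r ∨ E = (openDisc c r)ᶜ)

/-- An open annulus, defined over the completed algebraic closure of `K`: the complement in the
projective line of two disjoint closed discs `E₁`, `E₂`. (If it does not contain `∞` it is
`{r₁ < |T - c| < r₂}`.) The orientation is preserved by the Galois group: no conjugation exchanges
the two ends, i.e. `E₁` and `E₂` do not have the same image over `K`. -/
def IsOrientedOpenAnnulusOver (A : Set (P1 Ω)) : Prop :=
  ∃ E₁ E₂ : Set (P1 Ω), IsClosedDiscOver K E₁ ∧ IsClosedDiscOver K E₂ ∧ Disjoint E₁ E₂ ∧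
    A = (E₁ ∪ E₂)ᶜ ∧ proj K '' E₁ ≠ proj K '' E₂

end discs

/-- An open disc of the projective line over `L` (centre in `L`, or around `∞`). -/
def IsOpenDisc {L : Type*} [NormedField L] (D : Set (P1 L)) : Prop :=
  IsOpenDiscOver L D

/-- A closed disc of the projective line over `L`. It may be reduced to a rational point. -/
def IsClosedDisc {L : Type*} [NormedField L] (E : Set (P1 L)) : Prop :=
  IsClosedDiscOver L E ∨ ∃ z : OnePoint L, E = {rat z}

/-! ## Analytic domains, weak triangulations, skeletons

`Ω` is an algebraically closed complete extension of `K`; the completed algebraic closure of `K`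
is the closure in `Ω` of the set of elements that are algebraic over `K`. A subset of the
projective line over that field is detected by its inverse image over `Ω`. -/

section curves

variable (K Ω : Type*) [NormedField K] [NormedField Ω] [NormedAlgebra K Ω]

/-- A finite union of affinoid domains of the projective line over `K`: over the completed
algebraic closure it is a finite union of complements of finite non-empty unions of open discs. -/
def IsFiniteUnionOfAffinoids (W : Set (P1 K)) : Prop :=
  ∃ 𝒱 : Set (Set (Set (P1 Ω))), 𝒱.Finite ∧
    (∀ 𝒟 ∈ 𝒱, 𝒟.Finite ∧ 𝒟.Nonempty ∧ ∀ D ∈ 𝒟, IsOpenDiscOver K D) ∧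
    proj K ⁻¹' W = ⋃ 𝒟 ∈ 𝒱, (⋃₀ 𝒟)ᶜ

/-- An analytic domain of the projective line: each point has in `X` a neighbourhood that is a
finite union of affinoid domains. -/
def IsAnalyticDomain (X : Set (P1 K)) : Prop :=
  ∀ x ∈ X, ∃ W ⊆ X, IsFiniteUnionOfAffinoids K Ω W ∧ x ∈ W ∧ W ∈ nhdsWithin x X

/-- A virtual open disc: a connected subset that becomes a finite disjoint union of open discs
over the completed algebraic closure of `K`. -/
def IsVirtualOpenDisc (U : Set (P1 K)) : Prop :=
  IsConnected U ∧ ∃ 𝒟 : Set (Set (P1 Ω)), 𝒟.Finite ∧ 𝒟.PairwiseDisjoint id ∧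
    (∀ D ∈ 𝒟, IsOpenDiscOver K D) ∧ proj K ⁻¹' U = ⋃₀ 𝒟

/-- A virtual open annulus: a connected subset that becomes a finite disjoint union of open
annuli, with orientations preserved by Galois, over the completed algebraic closure of `K`. -/
def IsVirtualOpenAnnulus (U : Set (P1 K)) : Prop :=
  IsConnected U ∧ ∃ 𝒜 : Set (Set (P1 Ω)), 𝒜.Finite ∧ 𝒜.PairwiseDisjoint id ∧
    (∀ A ∈ 𝒜, IsOrientedOpenAnnulusOver K A) ∧ proj K ⁻¹' U = ⋃₀ 𝒜

/-- The skeleton of a virtual open annulus `U`: the points without neighbourhoods in `U` that are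
virtual open discs. -/
def annulusSkeleton (U : Set (P1 K)) : Set (P1 K) :=
  {y | y ∈ U ∧ ¬ ∃ V ⊆ U, IsVirtualOpenDisc K Ω V ∧ y ∈ V}

/-- A weak triangulation of `X`: a locally finite subset `S` such that each connected component of
`X - S` is a virtual open disc or a virtual open annulus. -/
def IsWeakTriangulation (X S : Set (P1 K)) : Prop :=
  S ⊆ X ∧ (∀ x ∈ X, ∃ U ∈ nhds x, (U ∩ S).Finite) ∧
    ∀ y ∈ X \ S, IsVirtualOpenDisc K Ω (connectedComponentIn (X \ S) y) ∨
      IsVirtualOpenAnnulus K Ω (connectedComponentIn (X \ S) y)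

/-- The skeleton `Γ_S`: the union of `S` and of the skeletons of the connected components of
`X - S` that are virtual open annuli. -/
def skeleton (X S : Set (P1 K)) : Set (P1 K) :=
  S ∪ {z | ∃ y ∈ X \ S, IsVirtualOpenAnnulus K Ω (connectedComponentIn (X \ S) y) ∧
    z ∈ annulusSkeleton K Ω (connectedComponentIn (X \ S) y)}

/-- The extension `S_Ω` of a weak triangulation `S`. Its elements are the canonical points of the
fibres over the points of `S`: a point of type 2 or 3 over the completed algebraic closure of `K`
has the form `x_{c,r}` with `c` algebraic over `K` and `r > 0`, and the canonical point of
its fibre is the point `x_{c,r}` over `Ω`. -/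
def extendTriangulation (S : Set (P1 K)) : Set (P1 Ω) :=
  {y | proj K y ∈ S ∧ ∃ (x : AffLine Ω) (c : Ω) (r : ℝ), y = (x : P1 Ω) ∧ IsAlgebraic K c ∧
    0 < r ∧ x.IsGauss c r}

variable {Ω}

/-- The connected component of `X_Ω - Γ_{S_Ω}` that contains the rational point `t`. -/
def maximalDisc (X S : Set (P1 K)) (t : OnePoint Ω) : Set (P1 Ω) :=
  connectedComponentIn
    ((proj K ⁻¹' X) \ skeleton Ω Ω (proj K ⁻¹' X) (extendTriangulation K Ω S)) (rat t)

end curves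

/-! ## Infinitesimal automorphisms and non degeneracy -/

/-- Each decreasing sequence of closed balls has a common point. -/
def IsSphericallyComplete (Ω : Type*) [NormedField Ω] : Prop :=
  ∀ (c : ℕ → Ω) (r : ℕ → ℝ), (∀ n, 0 ≤ r n) →
    (Antitone fun n => Metric.closedBall (c n) (r n)) →
    (⋂ n, Metric.closedBall (c n) (r n)).Nonempty

/-- The rational points of `D`. -/
abbrev RatPts {L : Type*} [NormedField L] (D : Set (P1 L)) : Type _ :=
  {z : OnePoint L // rat z ∈ D}

/-- The analytic functions on an open disc `D` over an algebraically closed complete field, as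
functions on the rational points of `D`: the sums of the power series in `T - c` that converge on
`D = {|T - c| < r}`, resp. of the power series in `(T - c)⁻¹` that converge on
`D = {|T - c| > r} ∪ {∞}`. -/
def analyticFunctions {L : Type*} [NormedField L] (D : Set (P1 L)) : Set (RatPts D → L) :=
  {f | ∃ (c : L) (r : ℝ) (a : ℕ → L), 0 < r ∧
    ((D = openDisc c r ∧
        ∀ (z : L) (hz : rat (z : OnePoint L) ∈ D),
          HasSum (fun n => a n * (z - c) ^ n) (f ⟨z, hz⟩)) ∨
      (D = (closedDisc c r)ᶜ ∧
        (∀ hz : rat (OnePoint.infty : OnePoint L) ∈ D, f ⟨OnePoint.infty, hz⟩ = a 0) ∧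
        ∀ (z : L) (hz : rat (z : OnePoint L) ∈ D),
          HasSum (fun n => a n * ((z - c)⁻¹) ^ n) (f ⟨z, hz⟩)))}

section infinitesimal

variable {K Ω : Type*} [NormedField K] [NormedField Ω] [NormedAlgebra K Ω]

/-- The analytic functions `f` on `D` with `f ∘ σ = f` for all the maps `σ : T ↦ qT + h` with
`(q, h) ∈ Sig`. -/
def invariantFunctions (Sig : Set (K × K)) (D : Set (P1 Ω)) : Set (RatPts D → Ω) :=
  {f | f ∈ analyticFunctions D ∧ ∀ s ∈ Sig, ∀ z w : RatPts D,
    w.1 = sigmaRat (algebraMap K Ω s.1) (algebraMap K Ω s.2) z.1 → f w = f z}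

variable (t : P1 K → OnePoint Ω)

/-- The map `T ↦ qT + h` is an `S`-infinitesimal automorphism of `X`: it induces an automorphism
of `X` and, over `Ω`, an automorphism of the maximal disc `D(x, S)` of each `x ∈ X`. Here `t x` is
the rational point over `x` that has been chosen to define `D(x, S)`. -/
def IsInfinitesimal (X S : Set (P1 K)) (q h : K) : Prop :=
  q ≠ 0 ∧ sigma q h '' X = X ∧
    ∀ x ∈ X, sigma (algebraMap K Ω q) (algebraMap K Ω h) '' maximalDisc K X S (t x) =
      maximalDisc K X S (t x)

/-- `D⁺(x, σ)`: the smallest closed disc in `D(x, S)` containing `t x` and `σ (t x)`. -/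
def stableDisc (X S : Set (P1 K)) (x : P1 K) (q h : K) : Set (P1 Ω) :=
  ⋂₀ {E | IsClosedDisc E ∧ E ⊆ maximalDisc K X S (t x) ∧ rat (t x) ∈ E ∧
    rat (sigmaRat (algebraMap K Ω q) (algebraMap K Ω h) (t x)) ∈ E}

/-- The family `Sig` of automorphisms `T ↦ qT + h`, `(q, h) ∈ Sig`, is non degenerate on `X`: each
connected component of `X` contains a point `x` such that on each open disc `D` with
`⋃_{σ} D⁺(x, σ) ⊆ D ⊆ D(x, S)` only the constants are invariant. -/
def IsNonDegenerate (X S : Set (P1 K)) (Sig : Set (K × K)) : Prop :=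
  ∀ y ∈ X, ∃ x ∈ connectedComponentIn X y, ∀ D : Set (P1 Ω), IsOpenDisc D →
    (⋃ s ∈ Sig, stableDisc t X S x s.1 s.2) ⊆ D → D ⊆ maximalDisc K X S (t x) →
      invariantFunctions Sig D = Set.range fun (a : Ω) (_ : RatPts D) => a

/-- The open annulus `C_ε = {1 - ε < |T| < 1}`. The Robba ring is the union of the rings of
analytic functions on the `C_ε`. -/
def robbaAnnulus (K : Type*) [NormedField K] (ε : ℝ) : Set (P1 K) :=
  (fun x : AffLine K => (x : P1 K)) '' {x | 1 - ε < x.1 X ∧ x.1 X < 1}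

/-- The map `T ↦ qT + h` is an infinitesimal automorphism of the Robba ring: it is induced by an
infinitesimal automorphism of some `C_ε`, with the empty weak triangulation. -/
def IsRobbaInfinitesimal (q h : K) : Prop :=
  ∃ ε : ℝ, 0 < ε ∧ ε < 1 ∧ IsInfinitesimal t (robbaAnnulus K ε) ∅ q h

/-- The family `Sig` is non degenerate over the Robba ring: there are arbitrarily small `ε` such
that the subfamily of those elements of `Sig` that are infinitesimal automorphisms of `C_ε` is non
degenerate on `C_ε`. -/
def IsRobbaNonDegenerate (Sig : Set (K × K)) : Prop :=
  ∀ ε : ℝ, 0 < ε → ∃ ε' : ℝ, 0 < ε' ∧ ε' < ε ∧ ε' < 1 ∧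
    IsNonDegenerate t (robbaAnnulus K ε') ∅
      {s ∈ Sig | IsInfinitesimal t (robbaAnnulus K ε') ∅ s.1 s.2}

end infinitesimal

end

end BerkovichLine

open BerkovichLine

/-! Write `σ` for `z ↦ qz + h`. Part (1) is an identity principle: a function invariant under `σ`
takes one value along a whole orbit, and an orbit that is infinite and stays well inside the disc of
convergence forces the power series to be constant. Infinite orbits are available because the
characteristic is `0` and `q` is either `1` with `h ≠ 0` or not a root of unity: every point other
than the at most one fixed point has an injective orbit (`IsAperiodic.iterate_injective`). The
identity principle is Strassmann's bound on the number of zeros (`card_zeros_le`,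
`coeff_eq_zero_of_hasSum`).

To confine an orbit to `{|T - c| ≤ s}` with `s < r`, consecutive differences are `qⁿ(σ(w) - w)`. For
`|q| ≤ 1` they do not grow, so the orbit stays as close to `c` as its first two points; for `|q| ≥
1` the inverse map is used. On a disc around `∞` functions are power series in `(T - c)⁻¹`, and an
orbit starting far enough out never comes closer to `c` under whichever of `σ`, `σ⁻¹` is not
contracting. On a disc not containing `∞` all that is needed of `D` is that it contains `t x` and
`σ(t x)`, which holds as soon as it contains `D⁺(x, σ)`; hence every point `x` witnesses
non-degeneracy (`isNonDegenerate_of_mem`).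

Part (2) adds that `σ` remains infinitesimal on the smaller annuli
(`IsInfinitesimal.robbaAnnulus_mono`). This rests on computing the maximal disc of a point of `C_ε`
over `Ω`: it is `{|T - t| < |t|}`, independently of `ε` (`maximalDisc_robbaAnnulus`). Since `|T|` is
constant on these discs, a map preserving each of them preserves every smaller annulus. -/

namespace BerkovichLine

open Filter Topology

/-! ### Zeros of power series: Strassmann's theorem -/

section Strassmann

variable {L : Type*} [NormedField L] [IsUltrametricDist L]

/-- Strassmann's theorem on the closed unit disc. -/
theorem card_zeros_le [CompleteSpace L] (N : ℕ) :
    ∀ a : ℕ → L, Tendsto a atTop (𝓝 0) → (∀ n, ‖a n‖ ≤ ‖a N‖) → (∀ n, N < n → ‖a n‖ < ‖a N‖) →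
      ∀ Z : Finset L, (∀ z ∈ Z, ‖z‖ ≤ 1 ∧
        Tendsto (fun M => ∑ n ∈ Finset.range M, a n * z ^ n) atTop (𝓝 0)) → Z.card ≤ N := by
  classical
  induction N with
  | zero =>
    intro a ha hle hlt Z hZ
    by_contra hcard
    obtain ⟨z, hz⟩ : Z.Nonempty := Finset.card_pos.1 (by omega)
    obtain ⟨hz1, hz0⟩ := hZ z hz
    have hpos : 0 < ‖a 0‖ := (norm_nonneg _).trans_lt (hlt 1 one_pos)
    -- The constant term strictly dominates all the others, so the partial sums cannot approach `0`.
    have hnorm : ∀ M : ℕ, ‖∑ n ∈ Finset.range (M + 1), a n * z ^ n‖ = ‖a 0‖ := by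
      intro M
      induction M with
      | zero => simp
      | succ M ih =>
        rw [Finset.sum_range_succ, IsUltrametricDist.norm_add_eq_max_of_norm_ne_norm, ih]
        · refine max_eq_left ?_
          rw [norm_mul, norm_pow]
          exact (mul_le_of_le_one_right (norm_nonneg _) (pow_le_one₀ (norm_nonneg _) hz1)).trans
            (hle _)
        · rw [ih, norm_mul, norm_pow]
          exact ((mul_le_of_le_one_right (norm_nonneg _)
            (pow_le_one₀ (norm_nonneg _) hz1)).trans_lt (hlt _ M.succ_pos)).ne'
    have h1 := (hz0.comp (tendsto_add_atTop_nat 1)).norm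
    simp only [Function.comp_def, hnorm, norm_zero] at h1
    exact hpos.ne' (tendsto_nhds_unique tendsto_const_nhds h1)
  | succ N ih =>
    intro a ha hle hlt Z hZ
    rcases Z.eq_empty_or_nonempty with rfl | ⟨w, hw⟩
    · simp
    obtain ⟨hw1, hw0⟩ := hZ w hw
    have hwp : ∀ k, ‖w ^ k‖ ≤ 1 := fun k => by
      rw [norm_pow]; exact pow_le_one₀ (norm_nonneg _) hw1
    have hbd : ∀ j k, ‖a (j + k) * w ^ k‖ ≤ ‖a (j + k)‖ := fun j k => by
      rw [norm_mul]; exact mul_le_of_le_one_right (norm_nonneg _) (hwp k)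
    have hsum : ∀ j, Summable fun k => a (j + k) * w ^ k := by
      intro j
      refine NonarchimedeanAddGroup.summable_of_tendsto_cofinite_zero ?_
      rw [Nat.cofinite_eq_atTop]
      refine squeeze_zero_norm (hbd j) ?_
      simpa [Function.comp_def] using (ha.comp (tendsto_add_atTop_nat j)).norm.congr
        fun k => by simp [add_comm]
    -- Division by `X - w`: the quotient has coefficients `T (j + 1)`, and `T 0` is the value at
    -- `w`.
    set T : ℕ → L := fun j => ∑' k, a (j + k) * w ^ k with hT
    have hTrec : ∀ j, T j = a j + w * T (j + 1) := by
      intro j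
      simp only [hT]
      rw [(hsum j).tsum_eq_zero_add, ← tsum_mul_left]
      simp only [add_zero, pow_zero, mul_one]
      congr 1
      refine tsum_congr fun k => ?_
      rw [show j + (k + 1) = j + 1 + k by ring]; ring
    have hTle : ∀ j C, (∀ k, ‖a (j + k)‖ ≤ C) → ‖T j‖ ≤ C := by
      intro j C hC
      refine le_of_tendsto (hsum j).hasSum.tendsto_sum_nat.norm (Eventually.of_forall fun M => ?_)
      have hC0 : 0 ≤ C := (norm_nonneg _).trans (hC 0)
      exact IsUltrametricDist.norm_sum_le_of_forall_le_of_nonneg hC0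
        fun k _ => (hbd j k).trans (hC k)
    have hT0 : T 0 = 0 :=
      tendsto_nhds_unique (by simpa [hT] using (hsum 0).hasSum.tendsto_sum_nat) hw0
    have hTlim : Tendsto T atTop (𝓝 0) := by
      rw [Metric.tendsto_atTop]
      intro e he
      obtain ⟨n₀, hn₀⟩ := Metric.tendsto_atTop.1 ha (e / 2) (half_pos he)
      refine ⟨n₀, fun j hj => ?_⟩
      rw [dist_zero_right]
      refine (hTle j (e / 2) fun k => ?_).trans_lt (half_lt_self he)
      have := hn₀ (j + k) (by omega)
      rw [dist_zero_right] at this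
      exact this.le
    have hpos : 0 < ‖a (N + 1)‖ := (norm_nonneg _).trans_lt (hlt _ (Nat.lt_succ_self _))
    have hTlt : ∀ j, N + 1 < j → ‖T j‖ < ‖a (N + 1)‖ := by
      intro j hj
      obtain ⟨m, hm⟩ := (Metric.tendsto_atTop.1 hTlim _ hpos)
      -- Passing to the limit in the sums would lose strictness. Instead the strict bound, true far
      -- out because `T` tends to `0`, is carried back down by `hTrec`.
      have hdown : ∀ k i, N + 1 < i → m ≤ i + k → ‖T i‖ < ‖a (N + 1)‖ := by
        intro k
        induction k with
        | zero => exact fun i _ hi => by simpa using hm i hi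
        | succ k ihk =>
          intro i hi hik
          rw [hTrec]
          refine (IsUltrametricDist.norm_add_le_max _ _).trans_lt (max_lt (hlt i hi) ?_)
          rw [norm_mul]
          exact (mul_le_of_le_one_left (norm_nonneg _) hw1).trans_lt
            (ihk (i + 1) (by omega) (by omega))
      exact hdown m j hj (by omega)
    have hTN : ‖T (N + 1)‖ = ‖a (N + 1)‖ := by
      have hlt' : ‖w * T (N + 1 + 1)‖ < ‖a (N + 1)‖ := by
        rw [norm_mul]
        exact (mul_le_of_le_one_left (norm_nonneg _) hw1).trans_lt (hTlt _ (Nat.lt_succ_self _))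
      rw [hTrec, IsUltrametricDist.norm_add_eq_max_of_norm_ne_norm hlt'.ne', max_eq_left hlt'.le]
    have hcard : (Z.erase w).card ≤ N := by
      refine ih (fun j => T (j + 1)) (hTlim.comp (tendsto_add_atTop_nat 1)) (fun n => ?_)
        (fun n hn => ?_) _ fun z hz => ?_
      · rw [hTN]; exact hTle _ _ fun k => hle _
      · rw [hTN]; exact hTlt _ (by omega)
      · obtain ⟨hzw, hzZ⟩ := Finset.mem_erase.1 hz
        obtain ⟨hz1, hz0⟩ := hZ z hzZ
        refine ⟨hz1, ?_⟩
        -- Truncated form of the factorisation by `X - w`; the case `M = 0` is the vanishing at `w`.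
        have key : ∀ M, (z - w) * ∑ j ∈ Finset.range M, T (j + 1) * z ^ j =
            T M * z ^ M + ∑ j ∈ Finset.range M, a j * z ^ j := by
          intro M
          induction M with
          | zero => simp [hT0]
          | succ M ihM =>
            rw [Finset.sum_range_succ, Finset.sum_range_succ, mul_add, ihM, hTrec M]
            ring
        have h1 : Tendsto (fun M => (z - w)⁻¹ * (T M * z ^ M + ∑ j ∈ Finset.range M, a j * z ^ j))
            atTop (𝓝 ((z - w)⁻¹ * (0 + 0))) := by
          refine ((squeeze_zero_norm (fun M => ?_) (by simpa using hTlim.norm)).add hz0).const_mul _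
          rw [norm_mul, norm_pow]
          exact mul_le_of_le_one_right (norm_nonneg _) (pow_le_one₀ (norm_nonneg _) hz1)
        refine (by simpa using h1 : Tendsto _ _ (𝓝 (0 : L))).congr fun M => ?_
        rw [← key, inv_mul_cancel_left₀ (sub_ne_zero.2 hzw)]
    rw [Finset.card_erase_of_mem hw] at hcard
    omega

/-- If some coefficient were nonzero, the maximal norm would be attained, for a last time at some
`N`, and `N + 1` of the zeros would contradict Strassmann's bound. -/
theorem eq_zero_of_infinite_zeros [CompleteSpace L] {a : ℕ → L} (ha : Tendsto a atTop (𝓝 0))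
    {u : ℕ → L} (hu : Function.Injective u) (hu1 : ∀ k, ‖u k‖ ≤ 1)
    (h0 : ∀ k, HasSum (fun n => a n * u k ^ n) 0) (n : ℕ) : a n = 0 := by
  by_contra hn
  have hpos : 0 < ‖a n‖ := norm_pos_iff.2 hn
  have hfin : ∀ m, a m ≠ 0 → {k | ‖a m‖ ≤ ‖a k‖}.Finite := by
    intro m hm
    obtain ⟨k₀, hk₀⟩ := Metric.tendsto_atTop.1 ha _ (norm_pos_iff.2 hm)
    refine (Set.finite_lt_nat k₀).subset fun k hk => ?_
    by_contra hlt
    have := hk₀ k (not_lt.1 hlt)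
    rw [dist_zero_right] at this
    exact absurd hk (not_le.2 this)
  obtain ⟨m, hm, hmax⟩ := (hfin n hn).exists_maximalFor (fun k => ‖a k‖) _ ⟨n, (le_refl ‖a n‖ :)⟩
  have hm0 : a m ≠ 0 := norm_pos_iff.1 (hpos.trans_le hm)
  have hle : ∀ k, ‖a k‖ ≤ ‖a m‖ := by
    intro k
    by_contra! hk
    exact absurd (hmax (hm.trans hk.le : ‖a n‖ ≤ ‖a k‖) hk.le) (not_le.2 hk)
  obtain ⟨N, hN, hNmax⟩ := (hfin m hm0).exists_maximalFor id _ ⟨m, (le_refl ‖a m‖ :)⟩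
  have hcard := card_zeros_le N a ha (fun k => (hle k).trans hN) (fun k hk => by
    by_contra! hk'
    exact absurd (hNmax (hN.trans hk' : ‖a m‖ ≤ ‖a k‖) hk.le) (not_le.2 hk))
    ((Finset.range (N + 1)).map ⟨u, hu⟩) (fun z hz => by
      obtain ⟨k, -, rfl⟩ := Finset.mem_map.1 hz
      exact ⟨hu1 k, (h0 k).tendsto_sum_nat⟩)
  simp at hcard

/-- A power series that takes the same value at infinitely many points of a closed disc contained
in its domain of convergence is constant. -/
theorem coeff_eq_zero_of_hasSum [CompleteSpace L] {a : ℕ → L} {p v : L} (hp : p ≠ 0)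
    (ha : Tendsto (fun n => a n * p ^ n) atTop (𝓝 0)) {u : ℕ → L} (hu : Function.Injective u)
    (hup : ∀ k, ‖u k‖ ≤ ‖p‖) (hv : ∀ k, HasSum (fun n => a n * u k ^ n) v) (n : ℕ) (hn : n ≠ 0) :
    a n = 0 := by
  -- Rescaling by `p` moves the points into the unit disc, and subtracting `v` from the constant
  -- term turns them into zeros.
  have hb : Tendsto (fun n => a n * p ^ n - if n = 0 then v else 0) atTop (𝓝 0) := by
    refine ha.congr' ?_
    filter_upwards [eventually_ge_atTop 1] with n hn
    simp [show n ≠ 0 by omega]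
  have := eq_zero_of_infinite_zeros hb (u := fun k => u k / p)
    (fun i j hij => hu (by simpa [hp] using hij))
    (fun k => by
      rw [norm_div]
      exact div_le_one_of_le₀ (hup k) (norm_nonneg _))
    (fun k => by
      have h1 := (hv k).sub (hasSum_ite_eq 0 v)
      rw [sub_self] at h1
      have hfun : (fun n => (a n * p ^ n - if n = 0 then v else 0) * (u k / p) ^ n) =
          fun n => a n * u k ^ n - if n = 0 then v else 0 := by
        funext i
        rcases eq_or_ne i 0 with rfl | hi
        · simp
        · simp only [hi, if_false, sub_zero]
          rw [mul_assoc, ← mul_pow, mul_div_cancel₀ _ hp]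
      rw [hfun]
      exact h1) n
  simpa [hn, hp] using this

end Strassmann

/-! ### Orbits of affine maps -/

section Orbits

variable {L : Type*} [NormedField L]

/-- The map multiplies differences by `q`, so consecutive differences along an orbit form a
geometric progression. -/
theorem iterate_affine_sub (q h w : L) (m k : ℕ) :
    (fun z => q * z + h)^[m + k] w - (fun z => q * z + h)^[m] w =
      q ^ m * (∑ i ∈ Finset.range k, q ^ i) * (q * w + h - w) := by
  have hstep : ∀ m, (fun z => q * z + h)^[m + 1] w - (fun z => q * z + h)^[m] w =
      q ^ m * (q * w + h - w) := by
    intro m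
    induction m with
    | zero => simp
    | succ m ih =>
      rw [Function.iterate_succ_apply', Function.iterate_succ_apply' _ m w, pow_succ', mul_assoc,
        ← ih, Function.iterate_succ_apply']
      ring
  induction k with
  | zero => simp
  | succ k ih =>
    rw [Finset.sum_range_succ, ← add_assoc]
    linear_combination hstep (m + k) + ih

/-- The map `z ↦ qz + h` is bijective, not the identity, and has no periodic points besides its
fixed points. -/
structure IsAperiodic (q h : L) : Prop where
  ne_zero : q ≠ 0
  translation : q = 1 → h ≠ 0
  pow_ne_one : q ≠ 1 → ∀ n : ℕ, 0 < n → q ^ n ≠ 1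

variable {q h : L}

theorem IsAperiodic.inv (H : IsAperiodic q h) : IsAperiodic q⁻¹ (-(q⁻¹ * h)) where
  ne_zero := inv_ne_zero H.ne_zero
  translation hq := by
    have := H.translation (inv_eq_one.1 hq)
    simp [H.ne_zero, this]
  pow_ne_one hq n hn := by
    rw [inv_pow, Ne, inv_eq_one]
    exact H.pow_ne_one (fun h1 => hq (by simp [h1])) n hn

theorem IsAperiodic.iterate_injective [CharZero L] (H : IsAperiodic q h) {w : L}
    (hw : q * w + h ≠ w) : Function.Injective fun n => (fun z => q * z + h)^[n] w := by
  have key : ∀ m k : ℕ, (fun z => q * z + h)^[m + (k + 1)] w ≠ (fun z => q * z + h)^[m] w := by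
    intro m k heq
    rw [← sub_eq_zero, iterate_affine_sub] at heq
    have h1 : ∑ i ∈ Finset.range (k + 1), q ^ i ≠ 0 := by
      rcases eq_or_ne q 1 with rfl | hq
      · simpa using Nat.cast_add_one_ne_zero k
      · rw [geom_sum_eq hq]
        exact div_ne_zero (sub_ne_zero.2 (H.pow_ne_one hq _ k.succ_pos)) (sub_ne_zero.2 hq)
    exact mul_ne_zero (mul_ne_zero (pow_ne_zero _ H.ne_zero) h1) (sub_ne_zero.2 hw) heq
  intro m n hmn
  rcases lt_trichotomy m n with hlt | rfl | hlt
  · obtain ⟨k, rfl⟩ := Nat.exists_eq_add_of_lt hlt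
    exact absurd hmn.symm (key m k)
  · rfl
  · obtain ⟨k, rfl⟩ := Nat.exists_eq_add_of_lt hlt
    exact absurd hmn (key n k)

theorem IsAperiodic.fixed_unique (H : IsAperiodic q h) {w z : L} (hw : q * w + h = w)
    (hz : q * z + h = z) : w = z := by
  have h1 : (q - 1) * (w - z) = 0 := by linear_combination hw - hz
  rcases mul_eq_zero.1 h1 with h2 | h2
  · have hq : q = 1 := sub_eq_zero.1 h2
    refine absurd ?_ (H.translation hq)
    linear_combination hw - w * h2
  · exact sub_eq_zero.1 h2

variable [IsUltrametricDist L]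

/-- The orbit of a non-fixed point of a disc `{|z - c| < r}` under a contracting map. -/
theorem IsAperiodic.exists_orbit_of_norm_le_one [CharZero L]
    (hval : ∀ r : ℝ, 0 ≤ r → ∃ z : L, ‖z‖ = r) (H : IsAperiodic q h) (hq : ‖q‖ ≤ 1) {c t : L}
    {r : ℝ} (ht : ‖t - c‖ < r) (hst : ‖q * t + h - c‖ < r) :
    ∃ (u : ℕ → L) (s : ℝ), Function.Injective u ∧ (∀ n, u (n + 1) = q * u n + h) ∧
      s < r ∧ ∀ n, ‖u n - c‖ ≤ s := by
  -- If `t` is the fixed point, a translate by an element of norm `r / 2` is not fixed and stays in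
  -- the disc together with its image.
  obtain ⟨w, hw, hsw, hfix⟩ : ∃ w, ‖w - c‖ < r ∧ ‖q * w + h - c‖ < r ∧ q * w + h ≠ w := by
    by_cases hfix : q * t + h = t
    · have hr : 0 < r := (norm_nonneg _).trans_lt ht
      obtain ⟨p, hp⟩ := hval (r / 2) (by positivity)
      have hp0 : p ≠ 0 := norm_pos_iff.1 (by rw [hp]; positivity)
      have hpr : ‖p‖ < r := by rw [hp]; exact half_lt_self hr
      refine ⟨t + p, ?_, ?_, fun h1 => hp0 ?_⟩
      · rw [add_sub_right_comm]
        exact (IsUltrametricDist.norm_add_le_max _ _).trans_lt (max_lt ht hpr)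
      · rw [show q * (t + p) + h - c = q * t + h - c + q * p by ring]
        refine (IsUltrametricDist.norm_add_le_max _ _).trans_lt (max_lt hst ?_)
        rw [norm_mul]
        exact (mul_le_of_le_one_left (norm_nonneg _) hq).trans_lt hpr
      · have := H.fixed_unique h1 hfix
        simpa using this
    · exact ⟨t, ht, hst, hfix⟩
  refine ⟨fun n => (fun z => q * z + h)^[n] w, max ‖w - c‖ ‖q * w + h - c‖,
    H.iterate_injective hfix, fun n => Function.iterate_succ_apply' _ _ _, max_lt hw hsw,
    fun n => ?_⟩
  induction n with
  | zero => exact le_max_left _ _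
  | succ n ih =>
    have h1 := iterate_affine_sub q h w n 1
    simp only [Finset.range_one, Finset.sum_singleton, pow_zero, mul_one] at h1
    rw [show (fun z => q * z + h)^[n + 1] w - c = (fun z => q * z + h)^[n] w - c +
      q ^ n * ((q * w + h - c) - (w - c)) by linear_combination h1]
    refine (IsUltrametricDist.norm_add_le_max _ _).trans (max_le ih ?_)
    rw [norm_mul, norm_pow]
    refine (mul_le_of_le_one_left (norm_nonneg _) (pow_le_one₀ (norm_nonneg _) hq)).trans ?_
    rw [max_comm, sub_eq_add_neg, ← norm_neg (w - c)]
    exact IsUltrametricDist.norm_add_le_max _ _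

/-- The orbit of a point near infinity under an expanding map. -/
theorem IsAperiodic.exists_orbit_of_one_le_norm [CharZero L]
    (hval : ∀ r : ℝ, 0 ≤ r → ∃ z : L, ‖z‖ = r) (H : IsAperiodic q h) (hq : 1 ≤ ‖q‖) (c : L)
    (r : ℝ) :
    ∃ (u : ℕ → L), Function.Injective u ∧ (∀ n, u (n + 1) = q * u n + h) ∧
      r < ‖u 0 - c‖ ∧ ∀ n, ‖u 0 - c‖ ≤ ‖u n - c‖ := by
  -- Beyond distance `R` from `c`, the term `q(v - c)` dominates `σ(c) - c`, so distances to `c` do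
  -- not decrease.
  set R := max (max r ‖q * c + h - c‖) 0 + 1 with hR
  have hrR : r < R := by
    have := (le_max_left r ‖q * c + h - c‖).trans (le_max_left _ 0); linarith
  have hcR : ‖q * c + h - c‖ < R := by
    have := (le_max_right r ‖q * c + h - c‖).trans (le_max_left _ 0); linarith
  have hR0 : 0 < R := by positivity
  -- Of two points at different distances from `c`, at most one is fixed.
  obtain ⟨w, hw, hfix⟩ : ∃ w, R ≤ ‖w - c‖ ∧ q * w + h ≠ w := by
    obtain ⟨p₁, hp₁⟩ := hval R hR0.le
    obtain ⟨p₂, hp₂⟩ := hval (R + 1) (by positivity)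
    by_cases h1 : q * (c + p₁) + h = c + p₁
    · refine ⟨c + p₂, by simp [hp₂], fun h2 => ?_⟩
      have := add_left_cancel (H.fixed_unique h1 h2)
      rw [this, hp₂] at hp₁
      linarith
    · exact ⟨c + p₁, by simp [hp₁], h1⟩
  refine ⟨fun n => (fun z => q * z + h)^[n] w, H.iterate_injective hfix,
    fun n => Function.iterate_succ_apply' _ _ _, hrR.trans_le hw, fun n => ?_⟩
  have hw' : R ≤ ‖(fun z => q * z + h)^[0] w - c‖ := hw
  induction n with
  | zero => exact le_rfl
  | succ n ih =>
    refine ih.trans ?_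
    have ih' := hw'.trans ih
    simp only [Function.iterate_succ_apply']
    set v := (fun z => q * z + h)^[n] w
    have h1 : ‖v - c‖ ≤ ‖q * (v - c)‖ := by
      rw [norm_mul]; exact le_mul_of_one_le_left (norm_nonneg _) hq
    have h2 : ‖q * c + h - c‖ < ‖q * (v - c)‖ := hcR.trans_le (ih'.trans h1)
    rw [show q * v + h - c = q * (v - c) + (q * c + h - c) by ring,
      IsUltrametricDist.norm_add_eq_max_of_norm_ne_norm h2.ne', max_eq_left h2.le]
    exact h1

/-- The two-sided recurrence allows orbits of the inverse map, which serve when `q` is expanding;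
invariance of a function can be read in either direction. -/
theorem IsAperiodic.exists_orbit_in_disc [CharZero L]
    (hval : ∀ r : ℝ, 0 ≤ r → ∃ z : L, ‖z‖ = r) (H : IsAperiodic q h) {c t : L}
    {r : ℝ} (ht : ‖t - c‖ < r) (hst : ‖q * t + h - c‖ < r) :
    ∃ (u : ℕ → L) (s : ℝ), Function.Injective u ∧
      (∀ n, u (n + 1) = q * u n + h ∨ u n = q * u (n + 1) + h) ∧ s < r ∧ ∀ n, ‖u n - c‖ ≤ s := by
  rcases le_total ‖q‖ 1 with hq | hq
  · obtain ⟨u, s, hu, hrec, hs⟩ := H.exists_orbit_of_norm_le_one hval hq ht hst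
    exact ⟨u, s, hu, fun n => .inl (hrec n), hs⟩
  · have h0 := H.ne_zero
    -- The roles of `t` and its image are exchanged: the inverse orbit is sought from `qt + h`,
    -- which the inverse sends back to `t`.
    obtain ⟨u, s, hu, hrec, hs⟩ := H.inv.exists_orbit_of_norm_le_one hval
      (by rw [norm_inv]; exact inv_le_one_of_one_le₀ hq) hst (by
        rwa [show q⁻¹ * (q * t + h) + -(q⁻¹ * h) - c = t - c by field_simp; ring])
    refine ⟨u, s, hu, fun n => .inr ?_, hs⟩
    rw [hrec]
    field_simp
    ring

theorem IsAperiodic.exists_orbit_near_infty [CharZero L]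
    (hval : ∀ r : ℝ, 0 ≤ r → ∃ z : L, ‖z‖ = r) (H : IsAperiodic q h) (c : L) (r : ℝ) :
    ∃ (u : ℕ → L), Function.Injective u ∧
      (∀ n, u (n + 1) = q * u n + h ∨ u n = q * u (n + 1) + h) ∧
      r < ‖u 0 - c‖ ∧ ∀ n, ‖u 0 - c‖ ≤ ‖u n - c‖ := by
  rcases le_total 1 ‖q‖ with hq | hq
  · obtain ⟨u, hu, hrec, hs⟩ := H.exists_orbit_of_one_le_norm hval hq c r
    exact ⟨u, hu, fun n => .inl (hrec n), hs⟩
  · have h0 := H.ne_zero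
    obtain ⟨u, hu, hrec, hs⟩ := H.inv.exists_orbit_of_one_le_norm hval
      (by rw [norm_inv]; exact (one_le_inv₀ (norm_pos_iff.2 h0)).2 hq) c r
    refine ⟨u, hu, fun n => .inr ?_, hs⟩
    rw [hrec]
    field_simp
    ring

end Orbits

/-! ### Invariant functions on discs and non-degeneracy -/

section Invariants

variable {L : Type*} [NormedField L]

theorem rat_coe (z : L) : rat (z : OnePoint L) = (AffLine.rat z : P1 L) := rfl

theorem sigmaRat_coe (q h z : L) :
    sigmaRat q h (z : OnePoint L) = ((q * z + h : L) : OnePoint L) := rfl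

theorem AffLine.rat_apply (z : L) (f : L[X]) : (AffLine.rat z).1 f = ‖f.eval z‖ := rfl

theorem coe_mem_openDisc {x : AffLine L} {c : L} {r : ℝ} :
    (x : P1 L) ∈ openDisc c r ↔ x.1 (X - C c) < r :=
  (OnePoint.coe_injective).mem_set_image

theorem coe_mem_closedDisc {x : AffLine L} {c : L} {r : ℝ} :
    (x : P1 L) ∈ closedDisc c r ↔ x.1 (X - C c) ≤ r :=
  (OnePoint.coe_injective).mem_set_image

theorem rat_mem_openDisc {z c : L} {r : ℝ} :
    rat (z : OnePoint L) ∈ openDisc c r ↔ ‖z - c‖ < r := by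
  rw [rat_coe, coe_mem_openDisc, AffLine.rat_apply]; simp

theorem rat_mem_closedDisc {z c : L} {r : ℝ} :
    rat (z : OnePoint L) ∈ closedDisc c r ↔ ‖z - c‖ ≤ r := by
  rw [rat_coe, coe_mem_closedDisc, AffLine.rat_apply]; simp

theorem infty_notMem_openDisc (c : L) (r : ℝ) : (OnePoint.infty : P1 L) ∉ openDisc c r := by
  rintro ⟨x, -, hx⟩
  exact OnePoint.coe_ne_infty x hx

theorem infty_notMem_closedDisc (c : L) (r : ℝ) : (OnePoint.infty : P1 L) ∉ closedDisc c r := by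
  rintro ⟨x, -, hx⟩
  exact OnePoint.coe_ne_infty x hx

theorem eq_const_of_invariant [CompleteSpace L] [IsUltrametricDist L] [CharZero L]
    (hval : ∀ r : ℝ, 0 ≤ r → ∃ z : L, ‖z‖ = r) {q h : L} (H : IsAperiodic q h)
    {D : Set (P1 L)} {t : OnePoint L} (ht : rat t ∈ D) (hst : rat (sigmaRat q h t) ∈ D)
    {f : RatPts D → L} (hf : f ∈ analyticFunctions D)
    (hinv : ∀ z w : RatPts D, w.1 = sigmaRat q h z.1 → f w = f z) : ∃ a, f = fun _ => a := by
  have horbit : ∀ (u : ℕ → L) (huD : ∀ n, rat (u n : OnePoint L) ∈ D),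
      (∀ n, u (n + 1) = q * u n + h ∨ u n = q * u (n + 1) + h) →
      ∀ n, f ⟨u n, huD n⟩ = f ⟨u 0, huD 0⟩ := by
    intro u huD hrec n
    induction n with
    | zero => rfl
    | succ n ih =>
      rw [← ih]
      rcases hrec n with h1 | h1
      · exact hinv ⟨u n, huD n⟩ ⟨u (n + 1), huD _⟩ (by rw [sigmaRat_coe, ← h1])
      · exact (hinv ⟨u (n + 1), huD _⟩ ⟨u n, huD n⟩ (by rw [sigmaRat_coe, ← h1])).symm
  obtain ⟨c, r, a, hr, ⟨rfl, hsum⟩ | ⟨rfl, hinf, hsum⟩⟩ := hf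
  · induction t using OnePoint.rec with
    | infty => exact absurd ht (infty_notMem_openDisc c r)
    | coe t =>
      rw [sigmaRat_coe] at hst
      obtain ⟨u, s, hu, hrec, hsr, hus⟩ :=
        H.exists_orbit_in_disc hval (rat_mem_openDisc.1 ht) (rat_mem_openDisc.1 hst)
      have huD : ∀ n, rat (u n : OnePoint L) ∈ openDisc c r := fun n =>
        rat_mem_openDisc.2 ((hus n).trans_lt hsr)
      -- The series must converge at a point at least as far from `c` as the orbit, hence a radius
      -- strictly between `max s 0` and `r`.
      obtain ⟨p, hp⟩ := hval ((max s 0 + r) / 2) (by positivity)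
      have hsr' : max s 0 < r := max_lt hsr hr
      have hp0 : p ≠ 0 := norm_pos_iff.1 (by rw [hp]; positivity)
      have hpr : ‖p‖ < r := by rw [hp]; linarith
      have hsp : s ≤ ‖p‖ := by rw [hp]; linarith [le_max_left s 0]
      have hpD : rat ((c + p : L) : OnePoint L) ∈ openDisc c r :=
        rat_mem_openDisc.2 (by simpa using hpr)
      have hlim := (hsum _ hpD).summable.tendsto_atTop_zero
      simp only [add_sub_cancel_left] at hlim
      have ha := coeff_eq_zero_of_hasSum hp0 hlim (u := fun n => u n - c)
        (fun i j hij => hu (sub_left_injective hij)) (fun n => (hus n).trans hsp)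
        (v := f ⟨u 0, huD 0⟩) (fun n => by
          rw [← horbit u huD hrec n]
          exact hsum _ (huD n))
      refine ⟨a 0, ?_⟩
      funext ⟨z, hz⟩
      induction z using OnePoint.rec with
      | infty => exact absurd hz (infty_notMem_openDisc c r)
      | coe z =>
        refine (hsum z hz).unique ?_
        convert hasSum_single (f := fun n => a n * (z - c) ^ n) 0 fun n hn => by simp [ha n hn]
        simp
  -- In the coordinate `(T - c)⁻¹` the orbit lies in the closed disc whose radius is given by its
  -- first point.
  · obtain ⟨u, hu, hrec, hru, hle⟩ := H.exists_orbit_near_infty hval c r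
    have huD : ∀ n, rat (u n : OnePoint L) ∈ (closedDisc c r)ᶜ := fun n hn =>
      absurd (rat_mem_closedDisc.1 hn) (not_le.2 (hru.trans_le (hle n)))
    have hpos : 0 < ‖u 0 - c‖ := hr.trans hru
    have ha := coeff_eq_zero_of_hasSum (inv_ne_zero (norm_pos_iff.1 hpos))
      (hsum _ (huD 0)).summable.tendsto_atTop_zero (u := fun n => (u n - c)⁻¹)
      (fun i j hij => hu (sub_left_injective (inv_injective hij)))
      (fun n => by
        rw [norm_inv, norm_inv]
        exact inv_anti₀ hpos (hle n))
      (v := f ⟨u 0, huD 0⟩) (fun n => by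
        rw [← horbit u huD hrec n]
        exact hsum _ (huD n))
    refine ⟨a 0, ?_⟩
    funext ⟨z, hz⟩
    induction z using OnePoint.rec with
    | infty => exact hinf hz
    | coe z =>
      refine (hsum z hz).unique ?_
      convert hasSum_single (f := fun n => a n * ((z - c)⁻¹) ^ n) 0 fun n hn => by simp [ha n hn]
      simp

theorem const_mem_analyticFunctions {D : Set (P1 L)} (hD : IsOpenDisc D) (a : L) :
    (fun _ : RatPts D => a) ∈ analyticFunctions D := by
  obtain ⟨c, r, -, hr, hD⟩ := hD
  have hsum : ∀ w : L, HasSum (fun n => (if n = 0 then a else 0) * w ^ n) a := fun w => by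
    convert hasSum_single (f := fun n => (if n = 0 then a else 0) * w ^ n) 0
      fun n hn => by simp [hn]
    simp
  exact ⟨c, r, fun n => if n = 0 then a else 0, hr,
    hD.imp (fun h => ⟨h, fun z _ => hsum _⟩) fun h => ⟨h, fun _ => rfl, fun z _ => hsum _⟩⟩

variable {K Ω : Type*} [NormedField K] [NormedField Ω] [NormedAlgebra K Ω]

theorem IsAperiodic.map {q h : K} (H : IsAperiodic q h) :
    IsAperiodic (algebraMap K Ω q) (algebraMap K Ω h) where
  ne_zero := by simpa using H.ne_zero
  translation hq := by
    have := H.translation ((algebraMap K Ω).injective (by simpa using hq))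
    simpa using this
  pow_ne_one hq n hn h1 := by
    refine H.pow_ne_one (fun h2 => hq (by simp [h2])) n hn ((algebraMap K Ω).injective ?_)
    simpa using h1

theorem isNonDegenerate_of_mem [CompleteSpace Ω] [IsUltrametricDist Ω] [CharZero Ω]
    (hval : ∀ r : ℝ, 0 ≤ r → ∃ z : Ω, ‖z‖ = r) (t : P1 K → OnePoint Ω) (X S : Set (P1 K))
    {Sig : Set (K × K)} {q h : K} (H : IsAperiodic q h) (hmem : (q, h) ∈ Sig) :
    IsNonDegenerate t X S Sig := by
  intro y hy
  refine ⟨y, mem_connectedComponentIn hy, fun D hD hsub _ => ?_⟩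
  -- Only the two points defining `D⁺` matter; they lie in the intersection because they lie in each
  -- of the closed discs intersected.
  have hstable : stableDisc t X S y q h ⊆ D := (Set.subset_biUnion_of_mem hmem).trans hsub
  have ht : rat (t y) ∈ D := hstable fun E hE => hE.2.2.1
  have hst : rat (sigmaRat (algebraMap K Ω q) (algebraMap K Ω h) (t y)) ∈ D :=
    hstable fun E hE => hE.2.2.2
  ext f
  constructor
  · rintro ⟨hf, hinv⟩
    obtain ⟨a, rfl⟩ := eq_const_of_invariant hval H.map ht hst hf (hinv _ hmem)
    exact ⟨a, rfl⟩
  · rintro ⟨a, rfl⟩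
    exact ⟨const_mem_analyticFunctions hD a, fun _ _ _ _ _ => rfl⟩

end Invariants

/-! ### Points of the line over `Ω`; connectedness of discs and annuli -/

section Points

variable {L : Type*} [NormedField L]

theorem AffLine.continuous_apply (f : L[X]) : Continuous fun x : AffLine L => x.1 f :=
  (_root_.continuous_apply f).comp continuous_induced_dom

theorem AffLine.continuous_iff {Y : Type*} [TopologicalSpace Y] {g : Y → AffLine L} :
    Continuous g ↔ ∀ f, Continuous fun y => (g y).1 f :=
  continuous_induced_rng.trans continuous_pi_iff

theorem isOpen_openDisc (c : L) (r : ℝ) : IsOpen (openDisc c r) :=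
  OnePoint.isOpenEmbedding_coe.isOpenMap _
    (isOpen_lt (AffLine.continuous_apply (X - C c)) continuous_const)

/-- Integers have norm at most `1`, so the binomial expansion bounds the `m`-th power of `|f + g|`
by `(m + 1) Mᵐ`; exponential growth beats linear growth. -/
theorem AffLine.isNonarchimedean [IsUltrametricDist L] (x : AffLine L) : IsNonarchimedean x.1 := by
  intro f g
  by_contra! hlt
  set M := max (x.1 f) (x.1 g) with hM
  have hf : x.1 f ≤ M := le_max_left _ _
  have hg : x.1 g ≤ M := le_max_right _ _
  have hM0 : 0 ≤ M := (apply_nonneg x.1 f).trans hf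
  have hpow : ∀ m : ℕ, x.1 (f + g) ^ m ≤ (m + 1) * M ^ m := by
    intro m
    rw [← map_pow, add_pow]
    have hsum : ∀ s : Finset ℕ, ∀ F : ℕ → L[X], x.1 (∑ i ∈ s, F i) ≤ ∑ i ∈ s, x.1 (F i) :=
      fun s F => Finset.le_sum_of_subadditive x.1 (map_zero x.1).le (map_add_le_add x.1) s F
    refine (hsum _ _).trans ((Finset.sum_le_card_nsmul _ _ (M ^ m) fun i hi => ?_).trans ?_)
    · have him : i ≤ m := Nat.lt_succ_iff.1 (Finset.mem_range.1 hi)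
      rw [map_mul, map_mul, map_pow, map_pow]
      have hc : x.1 ((m.choose i : ℕ) : L[X]) ≤ 1 := by
        rw [← C_eq_natCast, x.2]
        exact IsUltrametricDist.norm_natCast_le_one L _
      calc x.1 f ^ i * x.1 g ^ (m - i) * x.1 ((m.choose i : ℕ) : L[X])
          ≤ M ^ i * M ^ (m - i) * 1 := by
            gcongr
        _ = M ^ m := by rw [mul_one, ← pow_add, Nat.add_sub_cancel' him]
    · simp
  rcases hM0.eq_or_lt with h0 | h0
  · have := hpow 1
    rw [← h0] at this hlt
    simp at this
    exact absurd hlt (not_lt.2 this)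
  · obtain ⟨m, hm⟩ := Real.exists_natCast_add_one_lt_pow_of_one_lt ((one_lt_div h0).2 hlt)
    rw [div_pow, lt_div_iff₀ (pow_pos h0 m)] at hm
    exact absurd hm (not_lt.2 (hpow m))

theorem AffLine.apply_X_sub_C_le [IsUltrametricDist L] (x : AffLine L) (c d : L) :
    x.1 (X - C d) ≤ max (x.1 (X - C c)) ‖c - d‖ := by
  have := x.isNonarchimedean (X - C c) (C (c - d))
  rwa [x.2, show (X - C c + C (c - d) : L[X]) = X - C d by rw [C_sub]; ring] at this

theorem AffLine.norm_sub_le [IsUltrametricDist L] (x : AffLine L) (c d : L) :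
    ‖c - d‖ ≤ max (x.1 (X - C c)) (x.1 (X - C d)) := by
  have := x.isNonarchimedean (-(X - C c)) (X - C d)
  rwa [map_neg_eq_map, show (-(X - C c) + (X - C d) : L[X]) = C (c - d) by rw [C_sub]; ring,
    x.2] at this

theorem AffLine.apply_eq_prod_roots [IsAlgClosed L] (x : AffLine L) (f : L[X]) :
    x.1 f = ‖f.leadingCoeff‖ * (f.roots.map fun a => x.1 (X - C a)).prod := by
  conv_lhs => rw [(IsAlgClosed.splits f).eq_prod_roots]
  rw [map_mul, x.2, map_multiset_prod, Multiset.map_map]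
  rfl

/-- Over an algebraically closed field polynomials split, so a seminorm is determined by its values
on the `X - C c`. -/
theorem AffLine.ext_linear [IsAlgClosed L] {x y : AffLine L}
    (hxy : ∀ c, x.1 (X - C c) = y.1 (X - C c)) : x = y := by
  refine Subtype.ext (DFunLike.ext _ _ fun f => ?_)
  rw [x.apply_eq_prod_roots, y.apply_eq_prod_roots]
  simp only [hxy]

theorem gaussNorm_X_add_C [IsUltrametricDist L] {s : ℝ} (hs : 0 ≤ s) (b : L) :
    (X + C b).gaussNorm (NormedField.toAbsoluteValue L) s = max ‖b‖ s := by
  have hna : IsNonarchimedean (NormedField.toAbsoluteValue L) :=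
    IsUltrametricDist.isNonarchimedean_norm
  apply le_antisymm
  · refine (isNonarchimedean_gaussNorm _ hna hs X (C b)).trans ?_
    rw [gaussNorm_C, ← monomial_one_one_eq_X, gaussNorm_monomial, max_comm, map_one,
      one_mul, pow_one]
    rfl
  · refine max_le ?_ ?_
    · have := le_gaussNorm (NormedField.toAbsoluteValue L) (X + C b) hs 0
      rwa [coeff_add, coeff_X_zero, coeff_C_zero, zero_add, pow_zero, mul_one] at this
    · have := le_gaussNorm (NormedField.toAbsoluteValue L) (X + C b) hs 1
      rwa [coeff_add, coeff_X_one, coeff_C_succ, add_zero, map_one, one_mul, pow_one] at this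

/-- The point `x_{c,s}` for `s > 0`. -/
noncomputable def AffLine.gaussPoint [IsUltrametricDist L] (c : L) (s : ℝ) (hs : 0 < s) :
    AffLine L :=
  have hna : IsNonarchimedean (NormedField.toAbsoluteValue L) :=
    IsUltrametricDist.isNonarchimedean_norm
  have habs := gaussNorm_isAbsoluteValue hna hs
  ⟨{ toFun := fun f => (taylor c f).gaussNorm (NormedField.toAbsoluteValue L) s
     map_zero' := by simp
     add_le' := fun f g => by
      rw [map_add]
      exact habs.abv_add' _ _
     neg' := fun f => by
      rw [map_neg, ← neg_one_mul, habs.abv_mul', ← C_1, ← C_neg, gaussNorm_C]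
      simp
     map_one' := by
      rw [taylor_one, gaussNorm_C, map_one]
     map_mul' := fun f g => by
      rw [taylor_mul]
      exact habs.abv_mul' _ _ }, fun a => by
    change (taylor c (C a)).gaussNorm (NormedField.toAbsoluteValue L) s = ‖a‖
    rw [taylor_C, gaussNorm_C]
    rfl⟩

open Classical in
/-- The point `x_{c,s}`, which is the rational point `c` for `s ≤ 0`. -/
noncomputable def AffLine.discPoint [IsUltrametricDist L] (c : L) (s : ℝ) : AffLine L :=
  if hs : 0 < s then AffLine.gaussPoint c s hs else AffLine.rat c

/-- One formula for all real `s`, rational points included; it makes the paths `s ↦ x_{c,s}`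
continuous down to their rational end. -/
theorem AffLine.discPoint_apply [IsUltrametricDist L] (c d : L) (s : ℝ) :
    (AffLine.discPoint c s).1 (X - C d) = max ‖c - d‖ s := by
  unfold AffLine.discPoint
  split_ifs with hs
  · change (taylor c (X - C d)).gaussNorm (NormedField.toAbsoluteValue L) s = _
    rw [map_sub, taylor_X, taylor_C, add_sub_assoc, ← C_sub, gaussNorm_X_add_C hs.le]
  · rw [AffLine.rat_apply, max_eq_left ((not_lt.1 hs).trans (norm_nonneg _))]
    simp

theorem AffLine.continuous_discPoint [IsUltrametricDist L] [IsAlgClosed L] (c : L) :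
    Continuous (AffLine.discPoint c) := by
  refine AffLine.continuous_iff.2 fun f => ?_
  simp_rw [fun s => AffLine.apply_eq_prod_roots (AffLine.discPoint c s) f, AffLine.discPoint_apply]
  exact continuous_const.mul (continuous_multiset_prod _ fun a _ =>
    continuous_const.max continuous_id)

theorem AffLine.discPoint_eq [IsUltrametricDist L] [IsAlgClosed L] {c d : L} {s : ℝ}
    (h : ‖c - d‖ ≤ s) : AffLine.discPoint c s = AffLine.discPoint d s := by
  refine AffLine.ext_linear fun e => ?_
  rw [AffLine.discPoint_apply, AffLine.discPoint_apply]
  refine le_antisymm (max_le ?_ (le_max_right _ _)) (max_le ?_ (le_max_right _ _))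
  · rw [← sub_add_sub_cancel c d e]
    refine (IsUltrametricDist.norm_add_le_max _ _).trans (max_le (h.trans (le_max_right _ _))
      (le_max_left _ _))
  · rw [← sub_add_sub_cancel d c e]
    refine (IsUltrametricDist.norm_add_le_max _ _).trans (max_le ?_ (le_max_left _ _))
    rw [norm_sub_rev]
    exact h.trans (le_max_right _ _)

/-- Spherical completeness excludes points of type 4: a point common to a minimising sequence of
closed balls attains the infimum of `|T - c|(x)`, and the ultrametric inequality then gives the
values on all the other `X - C e`. -/
theorem AffLine.exists_eq_discPoint [IsUltrametricDist L] [IsAlgClosed L]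
    (hsph : IsSphericallyComplete L) (x : AffLine L) :
    ∃ (c : L) (s : ℝ), 0 ≤ s ∧ x = AffLine.discPoint c s := by
  set s := ⨅ c, x.1 (X - C c) with hs
  have hbdd : BddBelow (Set.range fun c => x.1 (X - C c)) :=
    ⟨0, by rintro _ ⟨c, rfl⟩; exact apply_nonneg _ _⟩
  have hs0 : 0 ≤ s := le_ciInf fun c => apply_nonneg _ _
  have hsle : ∀ c, s ≤ x.1 (X - C c) := fun c => ciInf_le hbdd c
  obtain ⟨v, hv, hvlim, hvmem⟩ := exists_seq_tendsto_sInf (Set.range_nonempty _) hbdd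
  choose c hc using hvmem
  simp only at hc
  obtain ⟨d, hd⟩ := hsph c v (fun n => by rw [← hc n]; exact apply_nonneg _ _) (by
    refine antitone_nat_of_succ_le fun n => ?_
    intro z hz
    rw [Metric.mem_closedBall, dist_eq_norm] at hz ⊢
    rw [← sub_add_sub_cancel z (c (n + 1)) (c n)]
    refine (IsUltrametricDist.norm_add_le_max _ _).trans (max_le (hz.trans (hv n.le_succ)) ?_)
    refine (x.norm_sub_le _ _).trans (max_le ?_ ?_)
    · rw [hc]; exact hv n.le_succ
    · rw [hc])
  have hds : x.1 (X - C d) = s := by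
    refine le_antisymm (ge_of_tendsto hvlim (Eventually.of_forall fun n => ?_)) (hsle d)
    refine (x.apply_X_sub_C_le (c n) d).trans (max_le (hc n).le ?_)
    have := Set.mem_iInter.1 hd n
    rwa [Metric.mem_closedBall, dist_comm, dist_eq_norm] at this
  refine ⟨d, s, hs0, AffLine.ext_linear fun e => ?_⟩
  rw [AffLine.discPoint_apply]
  refine le_antisymm ?_ (max_le ?_ (hsle e))
  · rw [max_comm, ← hds]; exact x.apply_X_sub_C_le d e
  · refine (x.norm_sub_le d e).trans (max_le ?_ le_rfl)
    rw [hds]; exact hsle e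

/-- The point `x_{d,s}` is joined to the centre by growing the radius around `d` until the disc
contains `c`, then shrinking it around `c`. -/
theorem isConnected_openDisc [IsUltrametricDist L] [IsAlgClosed L]
    (hsph : IsSphericallyComplete L) (c : L) {r : ℝ} (hr : 0 < r) :
    IsConnected (openDisc c r) := by
  refine ⟨⟨rat (c : OnePoint L), rat_mem_openDisc.2 (by simpa using hr)⟩, ?_⟩
  refine IsPreconnected.image ?_ _ OnePoint.continuous_coe.continuousOn
  refine isPreconnected_of_forall (AffLine.discPoint c 0) fun y hy => ?_
  obtain ⟨d, s, hs, rfl⟩ := y.exists_eq_discPoint hsph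
  rw [Set.mem_ofPred_eq, AffLine.discPoint_apply] at hy
  set p := max ‖d - c‖ s with hp
  have hp0 : 0 ≤ p := hs.trans (le_max_right _ _)
  refine ⟨AffLine.discPoint d '' Set.Icc s p ∪ AffLine.discPoint c '' Set.Icc 0 p, ?_,
    Or.inr ⟨0, ⟨le_rfl, hp0⟩, rfl⟩, Or.inl ⟨s, ⟨le_rfl, le_max_right _ _⟩, rfl⟩, ?_⟩
  · rintro _ (⟨u, hu, rfl⟩ | ⟨u, hu, rfl⟩)
    · rw [Set.mem_ofPred_eq, AffLine.discPoint_apply]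
      exact max_lt ((le_max_left _ _).trans_lt hy) (hu.2.trans_lt hy)
    · rw [Set.mem_ofPred_eq, AffLine.discPoint_apply, sub_self, norm_zero]
      exact max_lt hr (hu.2.trans_lt hy)
  · exact IsPreconnected.union (AffLine.discPoint d p) ⟨p, ⟨le_max_right _ _, le_rfl⟩, rfl⟩
      ⟨p, ⟨hp0, le_rfl⟩, (AffLine.discPoint_eq (le_max_left _ _)).symm⟩
      (isPreconnected_Icc.image _ (AffLine.continuous_discPoint d).continuousOn)
      (isPreconnected_Icc.image _ (AffLine.continuous_discPoint c).continuousOn)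

theorem coe_mem_robbaAnnulus {x : AffLine L} {e : ℝ} :
    (x : P1 L) ∈ robbaAnnulus L e ↔ 1 - e < x.1 X ∧ x.1 X < 1 :=
  (OnePoint.coe_injective).mem_set_image

theorem infty_notMem_robbaAnnulus (e : ℝ) : (OnePoint.infty : P1 L) ∉ robbaAnnulus L e := by
  rintro ⟨x, -, hx⟩
  exact OnePoint.coe_ne_infty x hx

theorem rat_mem_robbaAnnulus {z : L} {e : ℝ} :
    rat (z : OnePoint L) ∈ robbaAnnulus L e ↔ 1 - e < ‖z‖ ∧ ‖z‖ < 1 := by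
  rw [rat_coe, coe_mem_robbaAnnulus, AffLine.rat_apply, eval_X]

/-- A point is first moved to the skeleton `{x_{0,u}}` at constant `|T|`, then along the skeleton to
the radius `1 - e / 2`. -/
theorem isPreconnected_robbaAnnulus [IsUltrametricDist L] [IsAlgClosed L]
    (hsph : IsSphericallyComplete L) {e : ℝ} (he0 : 0 < e) (he1 : e ≤ 1) :
    IsPreconnected (robbaAnnulus L e) := by
  refine IsPreconnected.image ?_ _ OnePoint.continuous_coe.continuousOn
  have hX : ∀ (c : L) (s : ℝ), (AffLine.discPoint c s).1 X = max ‖c‖ s := fun c s => by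
    simpa using AffLine.discPoint_apply c 0 s
  have he2 := half_pos he0
  set p₀ := 1 - e / 2 with hp₀
  refine isPreconnected_of_forall (AffLine.discPoint 0 p₀) fun y hy => ?_
  obtain ⟨d, s, hs, rfl⟩ := y.exists_eq_discPoint hsph
  rw [Set.mem_ofPred_eq, hX] at hy
  set p := max ‖d‖ s with hp
  refine ⟨AffLine.discPoint d '' Set.Icc s p ∪ AffLine.discPoint 0 '' Set.uIcc p p₀, ?_,
    Or.inr ⟨p₀, Set.right_mem_uIcc, rfl⟩, Or.inl ⟨s, ⟨le_rfl, le_max_right _ _⟩, rfl⟩, ?_⟩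
  · rintro _ (⟨u, hu, rfl⟩ | ⟨u, hu, rfl⟩)
    · have : max ‖d‖ u = p :=
        le_antisymm (max_le (le_max_left _ _) hu.2) (max_le_max le_rfl hu.1)
      rw [Set.mem_ofPred_eq, hX, this]
      exact hy
    · have hu1 : 1 - e < u := (lt_min hy.1 (by linarith)).trans_le hu.1
      have hu2 : u < 1 := hu.2.trans_lt (max_lt hy.2 (by linarith))
      rw [Set.mem_ofPred_eq, hX, norm_zero, max_eq_right (by linarith)]
      exact ⟨hu1, hu2⟩
  · exact IsPreconnected.union (AffLine.discPoint d p) ⟨p, ⟨le_max_right _ _, le_rfl⟩, rfl⟩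
      ⟨p, Set.left_mem_uIcc, (AffLine.discPoint_eq (by simp [hp])).symm⟩
      (isPreconnected_Icc.image _ (AffLine.continuous_discPoint d).continuousOn)
      (isPreconnected_uIcc.image _ (AffLine.continuous_discPoint 0).continuousOn)

end Points

/-! ### Maximal discs of the annuli `C_ε` and restriction to smaller annuli -/

section Robba

variable {K Ω : Type*} [NormedField K] [NormedField Ω] [NormedAlgebra K Ω]

theorem AffLine.proj_apply (x : AffLine Ω) (f : K[X]) :
    (AffLine.proj K x).1 f = x.1 (f.map (algebraMap K Ω)) := rfl

theorem proj_coe (x : AffLine Ω) : proj K (x : P1 Ω) = (AffLine.proj K x : P1 K) := rfl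

theorem sigma_coe (q h : K) (x : AffLine K) :
    sigma q h (x : P1 K) = (AffLine.sigma q h x : P1 K) := rfl

theorem AffLine.sigma_apply (q h : K) (x : AffLine K) (f : K[X]) :
    (AffLine.sigma q h x).1 f = x.1 (f.comp (C q * X + C h)) := rfl

theorem AffLine.proj_self (x : AffLine K) : AffLine.proj K x = x := by
  refine Subtype.ext (DFunLike.ext _ _ fun f => ?_)
  rw [AffLine.proj_apply, Algebra.algebraMap_self, Polynomial.map_id]

theorem proj_self (x : P1 K) : proj K x = x := by
  induction x using OnePoint.rec with
  | infty => rfl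
  | coe x => rw [proj_coe, AffLine.proj_self]

theorem AffLine.proj_sigma (q h : K) (x : AffLine Ω) :
    AffLine.proj K (AffLine.sigma (algebraMap K Ω q) (algebraMap K Ω h) x) =
      AffLine.sigma q h (AffLine.proj K x) := by
  refine Subtype.ext (DFunLike.ext _ _ fun f => ?_)
  simp [AffLine.proj_apply, AffLine.sigma_apply, Polynomial.map_comp]

theorem preimage_robbaAnnulus (e : ℝ) :
    proj K ⁻¹' robbaAnnulus K e = robbaAnnulus Ω e := by
  ext x
  induction x using OnePoint.rec with
  | infty =>
    exact iff_of_false (infty_notMem_robbaAnnulus (L := K) e) (infty_notMem_robbaAnnulus e)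
  | coe x =>
    rw [Set.mem_preimage, proj_coe, coe_mem_robbaAnnulus, coe_mem_robbaAnnulus, AffLine.proj_apply,
      Polynomial.map_X]

theorem rat_self_mem_openDisc {c : Ω} {r : ℝ} (hr : 0 < r) : rat (c : OnePoint Ω) ∈ openDisc c r :=
  rat_mem_openDisc.2 (by simpa using hr)

theorem exists_coe_eq_of_mem_robbaAnnulus {t : P1 K → OnePoint Ω}
    (ht : ∀ x, proj K (rat (t x)) = x) {e : ℝ} {x : P1 K} (hx : x ∈ robbaAnnulus K e) :
    ∃ z : Ω, t x = z ∧ rat (z : OnePoint Ω) ∈ robbaAnnulus Ω e ∧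
      AffLine.proj K (AffLine.rat z) = x := by
  have h1 := ht x
  generalize t x = z at h1
  induction z using OnePoint.rec with
  | infty =>
    subst h1
    exact absurd hx (infty_notMem_robbaAnnulus e)
  | coe z =>
    refine ⟨z, rfl, ?_, h1⟩
    rw [← preimage_robbaAnnulus (K := K), Set.mem_preimage, h1]
    exact hx

section AlgClosed

variable {L : Type*} [NormedField L] [IsUltrametricDist L]

/-- The disc avoids `0`, so `|T|` is constant on it. -/
theorem apply_X_eq_of_mem_openDisc {x : AffLine L} {c : L}
    (hx : (x : P1 L) ∈ openDisc c ‖c‖) : x.1 X = ‖c‖ := by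
  have hx := coe_mem_openDisc.1 hx
  have h1 := x.apply_X_sub_C_le c 0
  have h2 := x.norm_sub_le c 0
  simp only [C_0, sub_zero] at h1 h2
  refine le_antisymm (h1.trans (max_le hx.le le_rfl)) ?_
  rcases le_max_iff.1 h2 with h3 | h3
  · exact absurd h3 (not_le.2 hx)
  · exact h3

theorem openDisc_subset_robbaAnnulus {c : L} {e : ℝ} (h : rat (c : OnePoint L) ∈ robbaAnnulus L e) :
    openDisc c ‖c‖ ⊆ robbaAnnulus L e := by
  rintro _ ⟨x, hx, rfl⟩
  rw [coe_mem_robbaAnnulus, apply_X_eq_of_mem_openDisc (coe_mem_openDisc.2 hx)]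
  exact rat_mem_robbaAnnulus.1 h

variable [IsAlgClosed L]

theorem isVirtualOpenAnnulus_robbaAnnulus (hsph : IsSphericallyComplete L)
    {e : ℝ} (he0 : 0 < e) (he1 : e < 1) (hne : (robbaAnnulus L e).Nonempty) :
    IsVirtualOpenAnnulus L L (robbaAnnulus L e) := by
  refine ⟨⟨hne, isPreconnected_robbaAnnulus hsph he0 he1.le⟩, {robbaAnnulus L e},
    Set.finite_singleton _, Set.pairwiseDisjoint_singleton _ _, ?_, ?_⟩
  · rintro _ rfl
    refine ⟨closedDisc 0 (1 - e), (openDisc 0 1)ᶜ,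
      ⟨0, 1 - e, isAlgebraic_zero, by linarith, .inl rfl⟩,
      ⟨0, 1, isAlgebraic_zero, one_pos, .inr rfl⟩, ?_, ?_, ?_⟩
    · rw [Set.disjoint_compl_right_iff_subset]
      rintro _ ⟨x, hx, rfl⟩
      exact coe_mem_openDisc.2 (lt_of_le_of_lt hx (by linarith))
    · ext x
      induction x using OnePoint.rec with
      | infty => simp [infty_notMem_robbaAnnulus, infty_notMem_openDisc]
      | coe x =>
        rw [Set.compl_union, compl_compl, Set.mem_inter_iff, Set.mem_compl_iff,
          coe_mem_closedDisc, coe_mem_openDisc, coe_mem_robbaAnnulus, C_0, sub_zero, not_le]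
    -- The projection is the identity here, and `0` lies in only one of the two closed discs.
    · intro heq
      have h0 : rat ((0 : L) : OnePoint L) ∈ proj L '' closedDisc (0 : L) (1 - e) :=
        ⟨_, rat_mem_closedDisc.2 (by simpa using he1.le), proj_self _⟩
      rw [heq] at h0
      obtain ⟨y, hy, hy0⟩ := h0
      rw [proj_self] at hy0
      subst hy0
      exact hy (rat_self_mem_openDisc one_pos)
  · rw [Set.sUnion_singleton]
    ext x
    rw [Set.mem_preimage, proj_self]

theorem isVirtualOpenDisc_openDisc (hsph : IsSphericallyComplete L) (c : L) {r : ℝ} (hr : 0 < r) :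
    IsVirtualOpenDisc L L (openDisc c r) := by
  refine ⟨isConnected_openDisc hsph c hr, {openDisc c r}, Set.finite_singleton _,
    Set.pairwiseDisjoint_singleton _ _, ?_, ?_⟩
  · rintro _ rfl
    exact ⟨c, r, isAlgebraic_algebraMap c, hr, .inl rfl⟩
  · rw [Set.sUnion_singleton]
    ext x
    rw [Set.mem_preimage, proj_self]

theorem skeleton_robbaAnnulus (hsph : IsSphericallyComplete L) {e : ℝ} (he0 : 0 < e) (he1 : e < 1) :
    skeleton L L (robbaAnnulus L e) ∅ = annulusSkeleton L L (robbaAnnulus L e) := by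
  have hcomp : ∀ y ∈ robbaAnnulus L e, connectedComponentIn (robbaAnnulus L e) y =
      robbaAnnulus L e := fun y hy =>
    (isPreconnected_robbaAnnulus hsph he0 he1.le).connectedComponentIn hy
  ext z
  simp only [skeleton, Set.empty_union, Set.sdiff_empty]
  constructor
  · rintro ⟨y, hy, -, hz⟩
    rwa [hcomp y hy] at hz
  · intro hz
    refine ⟨z, hz.1, ?_⟩
    rw [hcomp z hz.1]
    exact ⟨isVirtualOpenAnnulus_robbaAnnulus hsph he0 he1 ⟨z, hz.1⟩, hz⟩

/-- The complement of the skeleton is the union of the maximal open discs. -/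
theorem robbaAnnulus_diff_annulusSkeleton (hsph : IsSphericallyComplete L) {e : ℝ} (he1 : e < 1) :
    robbaAnnulus L e \ annulusSkeleton L L (robbaAnnulus L e) =
      ⋃ c ∈ {c : L | rat (c : OnePoint L) ∈ robbaAnnulus L e}, openDisc c ‖c‖ := by
  ext y
  simp only [Set.mem_iUnion, Set.mem_sdiff, annulusSkeleton, Set.mem_ofPred_eq, not_and, not_not,
    exists_prop]
  constructor
  · rintro ⟨hy, hV⟩
    obtain ⟨V, hVA, ⟨-, 𝒟, -, -, hdisc, hV⟩, hyV⟩ := hV hy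
    have hVeq : V = ⋃₀ 𝒟 := by
      rw [← hV]
      ext x
      rw [Set.mem_preimage, proj_self]
    rw [hVeq] at hyV hVA
    obtain ⟨D, hD, hyD⟩ := hyV
    have hDA : D ⊆ robbaAnnulus L e := (Set.subset_sUnion_of_mem hD).trans hVA
    obtain ⟨c, r, -, hr, rfl | rfl⟩ := hdisc D hD
    · refine ⟨c, hDA (rat_self_mem_openDisc hr), ?_⟩
      -- A larger disc would contain `0`, which is not in the annulus.
      have hrc : r ≤ ‖c‖ := by
        by_contra! hlt
        have h0 : rat ((0 : L) : OnePoint L) ∈ robbaAnnulus L e :=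
          hDA (rat_mem_openDisc.2 (by simpa using hlt))
        have := (rat_mem_robbaAnnulus.1 h0).1
        rw [norm_zero] at this
        linarith
      obtain ⟨x, hx, rfl⟩ := hyD
      exact coe_mem_openDisc.2 (lt_of_lt_of_le hx hrc)
    · exact absurd (hDA (infty_notMem_closedDisc c r)) (infty_notMem_robbaAnnulus e)
  · rintro ⟨c, hc, hy⟩
    have hsub := openDisc_subset_robbaAnnulus hc
    have hc0 : 0 < ‖c‖ := by linarith [(rat_mem_robbaAnnulus.1 hc).1]
    exact ⟨hsub hy, fun _ => ⟨_, hsub, isVirtualOpenDisc_openDisc hsph c hc0, hy⟩⟩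

/-- Two discs `{|T - c| < |c|}` are equal or disjoint, so the disc of `t` and the union of the discs
with `|c - t| ≥ |t|` split the set into disjoint open pieces. -/
theorem connectedComponentIn_iUnion_openDisc (hsph : IsSphericallyComplete L) {e : ℝ} (he1 : e < 1)
    {t : L} (ht : rat (t : OnePoint L) ∈ robbaAnnulus L e) :
    connectedComponentIn (⋃ c ∈ {c : L | rat (c : OnePoint L) ∈ robbaAnnulus L e}, openDisc c ‖c‖)
      (rat t) = openDisc t ‖t‖ := by
  have ht0 : 0 < ‖t‖ := by linarith [(rat_mem_robbaAnnulus.1 ht).1]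
  have hmem : rat (t : OnePoint L) ∈
      ⋃ c ∈ {c : L | rat (c : OnePoint L) ∈ robbaAnnulus L e}, openDisc c ‖c‖ :=
    Set.mem_biUnion (x := t) ht (rat_self_mem_openDisc ht0)
  refine Set.Subset.antisymm ?_
    ((isConnected_openDisc hsph t ht0).isPreconnected.subset_connectedComponentIn
      (rat_self_mem_openDisc ht0) (Set.subset_biUnion_of_mem (u := fun c : L => openDisc c ‖c‖) ht))
  refine isPreconnected_connectedComponentIn.subset_left_of_subset_union
    (v := ⋃ c ∈ {c : L | ‖t‖ ≤ ‖c - t‖}, openDisc c ‖c‖) (isOpen_openDisc _ _)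
    (isOpen_biUnion fun _ _ => isOpen_openDisc _ _) ?_ ?_
    ⟨rat t, mem_connectedComponentIn hmem, rat_self_mem_openDisc ht0⟩
  · rw [Set.disjoint_iUnion₂_right]
    intro c hc
    rw [Set.disjoint_left]
    rintro _ ⟨x, hxt, rfl⟩ hxc
    have hxc' := coe_mem_openDisc.1 hxc
    have h1 := apply_X_eq_of_mem_openDisc (coe_mem_openDisc.2 hxt)
    rw [apply_X_eq_of_mem_openDisc hxc] at h1
    rw [h1] at hxc'
    exact absurd (x.norm_sub_le c t) (not_le.2 ((max_lt hxc' hxt).trans_le hc))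
  · refine (connectedComponentIn_subset _ _).trans (Set.iUnion₂_subset fun c _ => ?_)
    rcases le_or_gt ‖t‖ ‖c - t‖ with h1 | h1
    · exact Set.subset_union_of_subset_right
        (Set.subset_biUnion_of_mem (u := fun c : L => openDisc c ‖c‖) h1) _
    · refine Set.subset_union_of_subset_left ?_ _
      have hct : ‖c‖ = ‖t‖ := by
        have := IsUltrametricDist.norm_add_eq_max_of_norm_ne_norm h1.ne
        rwa [sub_add_cancel, max_eq_right h1.le] at this
      rintro _ ⟨x, hx, rfl⟩
      rw [Set.mem_ofPred_eq, hct] at hx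
      exact coe_mem_openDisc.2 ((x.apply_X_sub_C_le c t).trans_lt (max_lt hx h1))

end AlgClosed

variable [IsUltrametricDist Ω] [IsAlgClosed Ω]

theorem maximalDisc_robbaAnnulus (hsph : IsSphericallyComplete Ω) {e : ℝ} (he0 : 0 < e)
    (he1 : e < 1) {t : Ω} (ht : rat (t : OnePoint Ω) ∈ robbaAnnulus Ω e) :
    maximalDisc K (robbaAnnulus K e) ∅ (t : OnePoint Ω) = openDisc t ‖t‖ := by
  have hempty : extendTriangulation K Ω ∅ = ∅ := by
    ext y
    simp [extendTriangulation]
  rw [maximalDisc, hempty, preimage_robbaAnnulus, skeleton_robbaAnnulus hsph he0 he1,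
    robbaAnnulus_diff_annulusSkeleton hsph he1, connectedComponentIn_iUnion_openDisc hsph he1 ht]

/-- An infinitesimal automorphism of `C_ε` is an infinitesimal automorphism of the smaller
annuli. -/
theorem IsInfinitesimal.robbaAnnulus_mono (hsph : IsSphericallyComplete Ω)
    {t : P1 K → OnePoint Ω} (ht : ∀ x, proj K (rat (t x)) = x) {q h : K} {e e' : ℝ}
    (he' : 0 < e') (hle : e' ≤ e) (he1 : e < 1)
    (H : IsInfinitesimal t (robbaAnnulus K e) ∅ q h) :
    IsInfinitesimal t (robbaAnnulus K e') ∅ q h := by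
  obtain ⟨hq, -, hD⟩ := H
  -- The maximal disc is the same for both annuli, so its stability is inherited.
  have hdisc : ∀ x ∈ robbaAnnulus K e', ∀ z : Ω, t x = z →
      rat (z : OnePoint Ω) ∈ robbaAnnulus Ω e' →
      sigma (algebraMap K Ω q) (algebraMap K Ω h) '' openDisc z ‖z‖ = openDisc z ‖z‖ := by
    rintro _ ⟨x, hx, rfl⟩ z hz hmem
    have hmem' := rat_mem_robbaAnnulus.1 hmem
    have := hD x ⟨x, ⟨by linarith [hx.1], hx.2⟩, rfl⟩
    rwa [hz, maximalDisc_robbaAnnulus hsph (he'.trans_le hle) he1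
      (rat_mem_robbaAnnulus.2 ⟨by linarith, hmem'.2⟩)] at this
  refine ⟨hq, ?_, fun x hx => ?_⟩
  -- Image and preimage of a point are found over `Ω`, inside the stable disc of its lift, and
  -- projected to `K`.
  · apply Set.Subset.antisymm
    · rintro _ ⟨x, hx, rfl⟩
      obtain ⟨z, hz, hmem, hzx⟩ := exists_coe_eq_of_mem_robbaAnnulus ht hx
      have hz0 : 0 < ‖z‖ := by linarith [(rat_mem_robbaAnnulus.1 hmem).1]
      have h1 : sigma (algebraMap K Ω q) (algebraMap K Ω h) (rat z) ∈ openDisc z ‖z‖ := by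
        rw [← hdisc x hx z hz hmem]
        exact Set.mem_image_of_mem _ (rat_self_mem_openDisc hz0)
      rw [rat_coe, sigma_coe] at h1
      rw [← hzx, sigma_coe, ← AffLine.proj_sigma, ← proj_coe, ← Set.mem_preimage,
        preimage_robbaAnnulus]
      exact openDisc_subset_robbaAnnulus hmem h1
    · intro y hy
      obtain ⟨z, hz, hmem, hzy⟩ := exists_coe_eq_of_mem_robbaAnnulus ht hy
      have hz0 : 0 < ‖z‖ := by linarith [(rat_mem_robbaAnnulus.1 hmem).1]
      have h1 := rat_self_mem_openDisc (c := z) hz0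
      rw [← hdisc y hy z hz hmem] at h1
      obtain ⟨_, hw, hwz⟩ := h1
      have hw' := openDisc_subset_robbaAnnulus hmem hw
      obtain ⟨w, -, rfl⟩ := hw
      refine ⟨proj K (w : P1 Ω), ?_, ?_⟩
      · rwa [← Set.mem_preimage, preimage_robbaAnnulus]
      · rw [sigma_coe, rat_coe, OnePoint.coe_eq_coe] at hwz
        rw [proj_coe, sigma_coe, ← AffLine.proj_sigma, hwz, hzy]
  · obtain ⟨z, hz, hmem, -⟩ := exists_coe_eq_of_mem_robbaAnnulus ht hx
    rw [hz, maximalDisc_robbaAnnulus hsph he' (hle.trans_lt he1) hmem]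
    exact hdisc x hx z hz hmem

end Robba
end BerkovichLine

theorem corollary6p2p2 {K Ω : Type*}
    [NormedField K] [CompleteSpace K] [IsUltrametricDist K] [CharZero K]
    [NormedField Ω] [NormedAlgebra K Ω] [CompleteSpace Ω] [IsUltrametricDist Ω] [IsAlgClosed Ω]
    (hsph : IsSphericallyComplete Ω) (hval : ∀ r : ℝ, 0 ≤ r → ∃ z : Ω, ‖z‖ = r)
    (t : P1 K → OnePoint Ω) (ht : ∀ x, proj K (rat (t x)) = x)
    (q h : K) (hh : q = 1 → h ≠ 0) (hq : q ≠ 1 → ∀ n : ℕ, 0 < n → q ^ n ≠ 1) :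
    (∀ X S : Set (P1 K), IsAnalyticDomain K Ω X → IsWeakTriangulation K Ω X S →
      IsInfinitesimal t X S q h →
      ¬ (IsOpenDisc X ∧ OnePoint.infty ∈ X ∧ S = ∅) →
      IsNonDegenerate t X S {(q, h)}) ∧
    (IsRobbaInfinitesimal t q h → IsRobbaNonDegenerate t {(q, h)}) := by
  have : CharZero Ω := charZero_of_injective_algebraMap (algebraMap K Ω).injective
  constructor
  · intro X S _ _ hinf _
    exact isNonDegenerate_of_mem hval t X S ⟨hinf.1, hh, hq⟩ rfl
  · rintro ⟨e, he0, he1, hinf⟩ d hd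
    -- The new annulus must satisfy the bound `d` and lie inside the one on which the map is known
    -- to be infinitesimal.
    have hpos : 0 < min d e / 2 := half_pos (lt_min hd he0)
    have hlt : min d e / 2 < min d e := half_lt_self (lt_min hd he0)
    have hle : min d e / 2 < e := hlt.trans_le (min_le_right _ _)
    exact ⟨min d e / 2, hpos, hlt.trans_le (min_le_left _ _), hle.trans he1,
      isNonDegenerate_of_mem hval t _ _ ⟨hinf.1, hh, hq⟩
        ⟨rfl, hinf.robbaAnnulus_mono hsph ht hpos hle.le he1⟩⟩
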